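/- An instance of makespan scheduling on $m$ uniform processors consists of processor speeds $s(1),\dots,s(m)>0$ and finitely many task sizes $t(1),\dots,t(n)\ge 0$; a schedule is a map $A:\{1,\dots,n\}\to\{1,\dots,m\}$ assigning each task to a processor. Running task $i$ on processor $p$ takes time $t(i)/s(p)$, and the makespan of $A$ is $\max_p \sum_{i:A(i)=p} t(i)/s(p)$. Let $\mathrm{OPT}$ be the minimum makespan over all schedules. The LPT algorithm takes the tasks one by one in non-increasing order of size and assigns each task $i$ to a processor $p$ minimizing $w(p)+t(i)/s(p)$, where $w(p)$ is the total time for which $p$ is already occupied by earlier tasks; ties (between tasks and between processors) are broken arbitrarily. An LPT schedule is any schedule that can arise in this way. Theorem. Let $m\in\{3,4,5\}$. The equation $2x^m-x^{m-1}-\cdots-x-2=0$ has exactly one positive root $\rho_m$; to within less than $0.005$ it equals $1.38$ for $m=3$, $1.43$ for $m=4$ and $1.46$ for $m=5$. The worst-case approximation ratio of LPT on $m$ uniform processors is exactly $\rho_m$, that is: 1. for every instance with $m$ processors and any number of tasks, every LPT schedule has makespan at most $\rho_m\cdot\mathrm{OPT}$; 2. there is an instance with $m$ processors and $m+1$ tasks,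 with $\mathrm{OPT}>0$, for which every LPT schedule has makespan exactly $\rho_m\cdot\mathrm{OPT}$. -/

import Mathlib

/-- The time at which processor `p`, of speed `s p`, finishes when it processes exactly the tasks
`i` in the set `S` that the assignment `A` gives to it. -/
noncomputable def busyTime {m n : ℕ} (s : Fin m → ℝ) (t : Fin n → ℝ) (A : Fin n → Fin m)
    (S : Finset (Fin n)) (p : Fin m) : ℝ :=
  ∑ i ∈ S with A i = p, t i / s p

/-- The makespan of the schedule `A`: the time at which the last processor finishes. -/
noncomputable def makespan {m n : ℕ} (s : Fin m → ℝ) (t : Fin n → ℝ) (A : Fin n → Fin m) : ℝ :=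
  ⨆ p : Fin m, busyTime s t A Finset.univ p

/-- The optimal makespan: the minimum over the finitely many assignments of tasks to processors. -/
noncomputable def optMakespan {m n : ℕ} (s : Fin m → ℝ) (t : Fin n → ℝ) : ℝ :=
  ⨅ A : Fin n → Fin m, makespan s t A

/-- `A` is a schedule that the LPT algorithm can output, under some way of breaking ties:
the tasks are taken one by one in an order `σ 0, σ 1, …` of non-increasing size, and task `σ k` is
given to a processor that minimizes `w p + t (σ k) / s p`, where `w p` is the time for which
processor `p` is already occupied by `σ 0, …, σ (k - 1)`. -/
def IsLPTSchedule {m n : ℕ} (s : Fin m → ℝ) (t : Fin n → ℝ) (A : Fin n → Fin m) : Prop :=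
  ∃ σ : Equiv.Perm (Fin n), Antitone (fun k => t (σ k)) ∧
    ∀ (k : Fin n) (p : Fin m),
      busyTime s t A ((Finset.Iio k).image σ) (A (σ k)) + t (σ k) / s (A (σ k)) ≤
        busyTime s t A ((Finset.Iio k).image σ) p + t (σ k) / s p

/-- The polynomial function `2 x ^ m - x ^ (m - 1) - ⋯ - x - 2`. -/
def lptPoly (m : ℕ) (x : ℝ) : ℝ :=
  2 * x ^ m - ∑ j ∈ Finset.Ico 1 m, x ^ j - 2

/-!
For the upper bound, consider an LPT schedule of ratio more than `L`. Cut it off at a task `z` that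
determines its makespan, and scale sizes so that `z`, a smallest task, has size `1`. Greediness says
that *every* processor would exceed `L` times its optimal capacity if it were given `z`
(`Overload`). Processors that the optimal schedule leaves idle can be removed. Then each processor
has a task other than `z` in the LPT schedule, so that `k` processors have at least `k + 1` tasks.

With exactly `k + 1` tasks, follow the walk that leads from a processor to the one on which its LPT
task runs in the optimal schedule, starting at the processor with two optimal tasks. The walk closes
up, and its inequalities combine to `lptPoly r L < 0` for its length `r`
(`Overload.exists_lptPoly_neg`), which is impossible when `L` is the root of `lptPoly m` and
`L < 3 / 2`, because `lptPoly r` decreases with `r` there. With more tasks, adding up all load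
inequalities shows that the total size is so small that the sizes are close to `1`
(`Overload.sum_size_lt`), whereas comparing the numbers of tasks per processor shows that they are
not (`Overload.sum_excess_ge`). For `m = 3, 4, 5` the two estimates contradict each other, for
`m = 5` only barely.

The walk of length `m` with all inequalities tight gives the extremal instance: with `v 0 = 2` and
`v (j + 1) = ρ * v j - 1`, which decreases to `v m = 1`, the speeds are `v 0, …, v (m - 1)` and the
task sizes `v 1, …, v m` and `1`. LPT is forced to give `v (j + 1)` to the processor of speed `v j`,
after which the last task finishes at time `ρ` on every processor
(`IsTightRatio.makespan_of_isLPTSchedule`), while the optimum is `1`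
(`IsTightRatio.optMakespan_eq_one`).
-/

/-! ### Overloaded assignments -/

theorem sum_fiber_eq_card_add_sum_sub_one {ι τ : Type*} [DecidableEq ι] (t : τ → ℝ) (S : Finset τ)
    (g : τ → ι) (p : ι) :
    ∑ i ∈ S with g i = p, t i =
      (S.filter fun i => g i = p).card + ∑ i ∈ S with g i = p, (t i - 1) := by
  simp

section Overload

variable {ι τ : Type*} [DecidableEq ι] [DecidableEq τ]

/-- What remains of an LPT schedule of ratio more than `L` when it is cut off just before the task
that determines its makespan, in units in which that last task `z` has size `1`. The assignment `f`
processes the tasks in `T` on the processors in `U` within the capacities `s` (speed times optimal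
makespan), whereas under `A`, which distributes only the tasks other than `z`, each processor would
exceed `L` times its capacity if it received `z` as well. The greedy order of LPT is forgotten, so
that processors can be removed together with their tasks. -/
structure Overload (L : ℝ) (s : ι → ℝ) (t : τ → ℝ) (A f : τ → ι) (z : τ)
    (U : Finset ι) (T : Finset τ) : Prop where
  mem : z ∈ T
  size_last : t z = 1
  one_le : ∀ i ∈ T, 1 ≤ t i
  map_mem : ∀ i ∈ T.erase z, A i ∈ U
  opt_mem : ∀ i ∈ T, f i ∈ U
  opt_load : ∀ p ∈ U, ∑ i ∈ T with f i = p, t i ≤ s p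
  load : ∀ p ∈ U, L * s p < ∑ i ∈ T.erase z with A i = p, t i + 1

namespace Overload

variable {L : ℝ} {s : ι → ℝ} {t : τ → ℝ} {A f : τ → ι} {z : τ} {U : Finset ι} {T : Finset τ}

/-- A processor that `f` leaves idle may be removed, together with the tasks it has under `A`. -/
theorem erase (h : Overload L s t A f z U T) {p : ι} (hp : ∀ i ∈ T, f i ≠ p) :
    Overload L s t A f z (U.erase p) (T.filter fun i => i = z ∨ A i ≠ p) where
  mem := by simp [h.mem]
  size_last := h.size_last
  one_le i hi := h.one_le i (Finset.mem_filter.1 hi).1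
  map_mem i hi := by
    simp only [Finset.mem_erase, Finset.mem_filter] at hi ⊢
    exact ⟨hi.2.2.resolve_left hi.1, h.map_mem i (Finset.mem_erase.2 ⟨hi.1, hi.2.1⟩)⟩
  opt_mem i hi := by
    have hi := (Finset.mem_filter.1 hi).1
    exact Finset.mem_erase.2 ⟨hp i hi, h.opt_mem i hi⟩
  opt_load q hq := by
    refine le_trans (Finset.sum_le_sum_of_subset_of_nonneg ?_ ?_)
      (h.opt_load q (Finset.mem_erase.1 hq).2)
    · exact Finset.filter_subset_filter _ (Finset.filter_subset _ _)
    · intro i hi _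
      linarith [h.one_le i (Finset.mem_filter.1 hi).1]
  load q hq := by
    have hq := Finset.mem_erase.1 hq
    convert h.load q hq.2 using 3
    ext i
    simp only [Finset.mem_filter, Finset.mem_erase]
    constructor
    · rintro ⟨⟨h1, h2, -⟩, h3⟩
      exact ⟨⟨h1, h2⟩, h3⟩
    · rintro ⟨⟨h1, h2⟩, h3⟩
      exact ⟨⟨h1, h2, Or.inr (h3 ▸ hq.1)⟩, h3⟩

theorem exists_surj (h : Overload L s t A f z U T) :
    ∃ U' ⊆ U, ∃ T', Overload L s t A f z U' T' ∧ ∀ p ∈ U', ∃ i ∈ T', f i = p := by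
  induction U using Finset.strongInduction generalizing T with
  | H U ih =>
    by_cases hs : ∀ p ∈ U, ∃ i ∈ T, f i = p
    · exact ⟨U, subset_rfl, T, h, hs⟩
    · push Not at hs
      obtain ⟨p, hp, hpf⟩ := hs
      obtain ⟨U', hU, T', h'⟩ := ih _ (Finset.erase_ssubset hp) (h.erase hpf)
      exact ⟨U', hU.trans (Finset.erase_subset _ _), T', h'⟩

/-- A processor that `f` uses has capacity at least `1`, hence carries a task under `A` too. -/
theorem exists_map_eq (h : Overload L s t A f z U T) (hL : 1 ≤ L) {p : ι} (hp : p ∈ U)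
    (hs : ∃ i ∈ T, f i = p) : ∃ i ∈ T.erase z, A i = p := by
  obtain ⟨j, hj, hjp⟩ := hs
  by_contra! hA
  have h1 := h.load p hp
  rw [Finset.filter_false_of_mem hA, Finset.sum_empty] at h1
  have h2 : t j ≤ ∑ i ∈ T with f i = p, t i :=
    Finset.single_le_sum (f := t)
      (fun i hi => by linarith [h.one_le i (Finset.mem_filter.1 hi).1]) (by simp [hj, hjp])
  nlinarith [h.opt_load p hp, h.one_le j hj]

/-- The total size is small: sum the load conditions over all processors. Since each task has size
at least `1`, this also bounds the number of tasks. -/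
theorem sum_size_lt (h : Overload L s t A f z U T) (hL : 0 ≤ L) :
    (L - 1) * ∑ i ∈ T, t i < U.card - 1 := by
  have h1 : ∑ p ∈ U, L * s p < ∑ p ∈ U, (∑ i ∈ T.erase z with A i = p, t i + 1) :=
    Finset.sum_lt_sum_of_nonempty ⟨f z, h.opt_mem z h.mem⟩ h.load
  have h2 := Finset.sum_le_sum h.opt_load
  rw [Finset.sum_fiberwise_of_maps_to h.opt_mem] at h2
  rw [Finset.sum_add_distrib, Finset.sum_fiberwise_of_maps_to h.map_mem, ← Finset.mul_sum,
    Finset.sum_const, nsmul_eq_mul, mul_one] at h1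
  have h3 := Finset.add_sum_erase T t h.mem
  rw [h.size_last] at h3
  nlinarith

/-- The load condition at the processor that `f` gives the task `a`, in terms of the number of tasks
and of the excesses `t i - 1`; of the excesses under `f` only that of `a` is kept. -/
theorem excess_add_gt (h : Overload L s t A f z U T) (hL : 0 ≤ L) {a : τ} (ha : a ∈ T) :
    L * ((T.filter fun i => f i = f a).card + (t a - 1)) <
      ((T.erase z).filter fun i => A i = f a).card +
        ∑ i ∈ T.erase z with A i = f a, (t i - 1) + 1 := by
  have h1 := h.load _ (h.opt_mem a ha)
  have h2 := h.opt_load _ (h.opt_mem a ha)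
  rw [sum_fiber_eq_card_add_sum_sub_one] at h1 h2
  have h3 : t a - 1 ≤ ∑ i ∈ T with f i = f a, (t i - 1) :=
    Finset.single_le_sum (f := fun i => t i - 1)
      (fun i hi => by linarith [h.one_le i (Finset.mem_filter.1 hi).1]) (by simp [ha])
  nlinarith [mul_le_mul_of_nonneg_left h2 hL, mul_le_mul_of_nonneg_left h3 hL]

/-- If `f` uses all processors, the sizes cannot all be close to `1`. Write `o p` and `w p` for the
number of tasks of `p` under `f` and `A`, and `E p` for the total excess `t i - 1` of the tasks that
`p` has under `A`. Since `f` distributes one task more than `A`, some `p` has `w p < o p`, and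
this forces `E p > (L - 1) * (w p + 1)`. The largest task of `p` under `A` is then so large that the
processor to which `f` assigns it, which cannot be `p`, has a large `E` as well, unless it receives
fewer tasks from `f` than from `A`, in which case there is a second processor with `w < o`. -/
theorem sum_excess_ge (h : Overload L s t A f z U T) (hL1 : 1 < L) (hL2 : L ≤ 3 / 2)
    (hs : ∀ p ∈ U, ∃ i ∈ T, f i = p) :
    2 * L ^ 2 + L - 4 ≤ ∑ i ∈ T, (t i - 1) := by
  by_contra! hE
  set w : ι → ℕ := fun p => ((T.erase z).filter fun i => A i = p).card with hw
  set o : ι → ℕ := fun p => (T.filter fun i => f i = p).card with ho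
  set E : ι → ℝ := fun p => ∑ i ∈ T.erase z with A i = p, (t i - 1) with hEdef
  have hEnn : ∀ p, 0 ≤ E p := fun p => Finset.sum_nonneg fun i hi => by
    linarith [h.one_le i (Finset.mem_of_mem_erase (Finset.mem_filter.1 hi).1)]
  have hEsum : ∑ p ∈ U, E p = ∑ i ∈ T, (t i - 1) := by
    rw [hEdef, Finset.sum_fiberwise_of_maps_to h.map_mem,
      ← Finset.add_sum_erase T _ h.mem, h.size_last]
    ring
  have hwsum : ∑ p ∈ U, w p = (T.erase z).card :=
    (Finset.card_eq_sum_card_fiberwise h.map_mem).symm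
  have hosum : ∑ p ∈ U, o p = T.card := (Finset.card_eq_sum_card_fiberwise h.opt_mem).symm
  have hcard : (T.erase z).card + 1 = T.card := Finset.card_erase_add_one h.mem
  have hwpos : ∀ p ∈ U, 1 ≤ w p := fun p hp => by
    obtain ⟨i, hi, hip⟩ := h.exists_map_eq hL1.le hp (hs p hp)
    exact Finset.card_pos.2 ⟨i, Finset.mem_filter.2 ⟨hi, hip⟩⟩
  -- The excess of one or two processors is below the assumed bound on the total.
  have hpair : ∀ p ∈ U, ∀ q ∈ U, p ≠ q → E p + E q < 2 * L ^ 2 + L - 4 := by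
    intro p hp q hq hpq
    refine lt_of_le_of_lt ?_ hE
    rw [← hEsum, ← Finset.sum_pair hpq]
    exact Finset.sum_le_sum_of_subset_of_nonneg
      (by simp [Finset.insert_subset_iff, hp, hq]) fun i _ _ => hEnn i
  have hsingle : ∀ p ∈ U, E p < 2 * L ^ 2 + L - 4 := by
    intro p hp
    refine lt_of_le_of_lt ?_ hE
    rw [← hEsum]
    exact Finset.single_le_sum (fun i _ => hEnn i) hp
  have hload : ∀ a ∈ T, L * (o (f a) + (t a - 1)) < w (f a) + E (f a) + 1 :=
    fun a ha => h.excess_add_gt (by linarith) ha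
  have hload' : ∀ p ∈ U, L * o p < w p + E p + 1 := fun p hp => by
    obtain ⟨i, hi, rfl⟩ := hs p hp
    nlinarith [hload i hi, h.one_le i hi]
  have hbig : ∀ p ∈ U, w p < o p → (L - 1) * (w p + 1) < E p := fun p hp hpo => by
    have : (w p : ℝ) + 1 ≤ o p := by exact_mod_cast hpo
    nlinarith [hload' p hp]
  obtain ⟨p, hp, hpo⟩ : ∃ p ∈ U, w p < o p := by
    refine Finset.exists_lt_of_sum_lt ?_
    omega
  have hEp := hbig p hp hpo
  have hpo' : (w p : ℝ) + 1 ≤ o p := by exact_mod_cast hpo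
  have hw2 : w p ≤ 2 := by
    by_contra! hc
    have : (3 : ℝ) ≤ w p := by exact_mod_cast hc
    nlinarith [hsingle p hp]
  have hop : o p = w p + 1 := by
    by_contra hc
    have h1 : (w p : ℝ) + 2 ≤ o p := by
      exact_mod_cast (show w p + 2 ≤ o p by omega)
    have h2 : (1 : ℝ) ≤ w p := by exact_mod_cast hwpos p hp
    nlinarith [hsingle p hp, hload' p hp]
  -- `a` is the largest of the at most two tasks that `p` has under `A`.
  obtain ⟨a, ha, haE⟩ : ∃ a ∈ (T.erase z).filter fun i => A i = p, E p ≤ w p * (t a - 1) := by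
    have hne : ((T.erase z).filter fun i => A i = p).Nonempty :=
      Finset.card_pos.1 (hwpos p hp)
    obtain ⟨a, ha, hmax⟩ := Finset.exists_max_image _ (fun i => t i - 1) hne
    refine ⟨a, ha, ?_⟩
    have := Finset.sum_le_card_nsmul _ _ _ hmax
    simpa [hw, hEdef] using this
  have haT : a ∈ T := Finset.mem_of_mem_erase (Finset.mem_filter.1 ha).1
  have hr := h.opt_mem a haT
  have hla := hload a haT
  have hw12 : w p = 1 ∨ w p = 2 := by have := hwpos p hp; omega
  by_cases hrp : f a = p
  · rw [hrp, hop] at hla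
    have h1 := hsingle p hp
    rcases hw12 with hw1 | hw1 <;> rw [hw1] at hla haE hEp <;> push_cast at hla haE hEp
    · nlinarith
    · nlinarith
  by_cases hwr : w (f a) ≤ o (f a)
  · have h1 := hpair p hp _ hr (Ne.symm hrp)
    have h2 : (w (f a) : ℝ) ≤ o (f a) := by exact_mod_cast hwr
    have h3 : (1 : ℝ) ≤ w (f a) := by exact_mod_cast hwpos _ hr
    have h4 : L - 1 + L * (t a - 1) - 1 < E (f a) := by nlinarith
    rcases hw12 with hw1 | hw1 <;> rw [hw1] at haE hEp <;> push_cast at haE hEp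
    · nlinarith
    · nlinarith
  · -- `p` and `f a` together receive at most as many tasks from `f` as from `A`.
    obtain ⟨q, hq, hqo⟩ : ∃ q ∈ (U.erase p).erase (f a), w q < o q := by
      refine Finset.exists_lt_of_sum_lt ?_
      have hr' : f a ∈ U.erase p := Finset.mem_erase.2 ⟨hrp, hr⟩
      have h1 := Finset.add_sum_erase U w hp
      have h2 := Finset.add_sum_erase U o hp
      have h3 := Finset.add_sum_erase (U.erase p) w hr'
      have h4 := Finset.add_sum_erase (U.erase p) o hr'
      omega
    have hq' := Finset.mem_erase.1 (Finset.mem_erase.1 hq).2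
    have h1 := hpair p hp q hq'.2 (Ne.symm hq'.1)
    have h2 := hbig q hq'.2 hqo
    have h3 : (1 : ℝ) ≤ w p := by exact_mod_cast hwpos p hp
    have h4 : (1 : ℝ) ≤ w q := by exact_mod_cast hwpos q hq'.2
    nlinarith

/-- With one task more than processors, `A` gives exactly one task `π p` to each processor `p`, and
`f` gives two tasks to one processor `q` and one to each other processor. Capacities along the walk
`q, f (π q), f (π (f (π q))), …` satisfy `s (f (π p)) ≥ t (π p) > L * s p - 1`. The walk
returns to `q`, after `r` steps say, and there the last task shares `q` with another one, so that
`s q ≥ t + 1`. Eliminating the capacities leaves a polynomial inequality in `L`. -/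
theorem exists_lptPoly_neg (h : Overload L s t A f z U T) (hL1 : 1 < L)
    (hs : ∀ p ∈ U, ∃ i ∈ T, f i = p) (hcard : T.card = U.card + 1) :
    ∃ r, 1 ≤ r ∧ r ≤ U.card ∧ lptPoly r L < 0 := by
  have hsurjA : Set.SurjOn A (T.erase z) U := fun p hp => by
    obtain ⟨i, hi, hip⟩ := h.exists_map_eq hL1.le hp (hs p hp)
    exact ⟨i, hi, hip⟩
  have hcard' : (T.erase z).card = U.card := by
    rw [Finset.card_erase_of_mem h.mem, hcard]; rfl
  have hinjA : Set.InjOn A (T.erase z) :=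
    Finset.injOn_of_surjOn_of_card_le A h.map_mem hsurjA hcard'.le
  -- `f a = f b` is the only processor with two tasks under `f`.
  obtain ⟨a, ha, b, hb, hab, hfab⟩ : ∃ a ∈ T, ∃ b ∈ T, a ≠ b ∧ f a = f b :=
    Finset.exists_ne_map_eq_of_card_lt_of_maps_to (by omega) h.opt_mem
  have hinjf : Set.InjOn f (T.erase a) := by
    refine Finset.injOn_of_surjOn_of_card_le (t := U) f
      (fun i hi => h.opt_mem i (Finset.mem_of_mem_erase hi)) (fun p hp => ?_) ?_
    · obtain ⟨i, hi, hip⟩ := hs p hp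
      by_cases hia : i = a
      · exact ⟨b, by simp [hb, hab.symm], by rw [← hip, hia, hfab]⟩
      · exact ⟨i, by simp [hi, hia], hip⟩
    · rw [Finset.card_erase_of_mem ha, hcard]; rfl
  have hinjf' : ∀ i ∈ T, ∀ j ∈ T, f i = f j → f i ≠ f a → i = j := by
    intro i hi j hj hij hne
    have hia : i ≠ a := fun e => hne (e ▸ rfl)
    have hja : j ≠ a := fun e => hne (hij.trans (e ▸ rfl))
    exact hinjf (by simp [hi, hia]) (by simp [hj, hja]) hij
  have : Nonempty τ := ⟨z⟩
  choose! π hπT hπA using fun p (hp : p ∈ U) => h.exists_map_eq hL1.le hp (hs p hp)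
  have hπ : ∀ p ∈ U, π p ∈ T := fun p hp => Finset.mem_of_mem_erase (hπT p hp)
  have hload : ∀ p ∈ U, L * s p < t (π p) + 1 := fun p hp => by
    have h1 := h.load p hp
    have h2 : (T.erase z).filter (fun i => A i = p) = {π p} := by
      ext i
      simp only [Finset.mem_filter, Finset.mem_singleton]
      constructor
      · rintro ⟨hi, hip⟩
        exact hinjA hi (hπT p hp) (hip.trans (hπA p hp).symm)
      · rintro rfl
        exact ⟨hπT p hp, hπA p hp⟩
    rwa [h2, Finset.sum_singleton] at h1
  have hopt : ∀ i ∈ T, t i ≤ s (f i) := fun i hi =>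
    (Finset.single_le_sum (f := t)
      (fun i hi => by linarith [h.one_le i (Finset.mem_filter.1 hi).1])
      (by simp [hi])).trans (h.opt_load _ (h.opt_mem i hi))
  have hopt' : ∀ i ∈ T, f i = f a → t i + 1 ≤ s (f a) := fun i hi hia => by
    obtain ⟨j, hj, hji, hjf⟩ : ∃ j ∈ T, i ≠ j ∧ f j = f a := by
      by_cases e : i = a
      · exact ⟨b, hb, e ▸ hab, hfab.symm⟩
      · exact ⟨a, ha, e, rfl⟩
    have h1 : ∑ k ∈ {i, j}, t k ≤ ∑ k ∈ T with f k = f a, t k :=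
      Finset.sum_le_sum_of_subset_of_nonneg
        (by simp [Finset.insert_subset_iff, hi, hj, hia, hjf])
        (fun k hk _ => by linarith [h.one_le k (Finset.mem_filter.1 hk).1])
    rw [Finset.sum_pair hji] at h1
    linarith [h.opt_load _ (h.opt_mem a ha), h.one_le j hj]
  set x : ℕ → ι := fun n => (fun p => f (π p))^[n] (f a) with hx
  have hx0 : x 0 = f a := rfl
  have hxs : ∀ n, x (n + 1) = f (π (x n)) := fun n => Function.iterate_succ_apply' _ _ _
  have hxU : ∀ n, x n ∈ U := fun n => by
    induction n with
    | zero => exact h.opt_mem a ha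
    | succ n ih => rw [hxs]; exact h.opt_mem _ (hπ _ ih)
  obtain ⟨r, hr1, hrU, hxr⟩ : ∃ r, 1 ≤ r ∧ r ≤ U.card ∧ x r = f a := by
    -- Off `f a` the step is injective, so a walk that never returned would not repeat at all.
    by_contra! hret
    have hne : ∀ i j, i < j → j ≤ U.card → x i ≠ x j := by
      intro i
      induction i with
      | zero => exact fun j hj hjU e => hret j hj hjU e.symm
      | succ i ih =>
        intro j hij hjU e
        obtain ⟨j, rfl⟩ : ∃ l, j = l + 1 := ⟨j - 1, by omega⟩
        rw [hxs, hxs] at e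
        have h1 := hinjf' _ (hπ _ (hxU i)) _ (hπ _ (hxU j)) e
          (by rw [← hxs]; exact hret _ (by omega) (by omega))
        refine ih j (by omega) (by omega) ?_
        rw [← hπA _ (hxU i), h1, hπA _ (hxU j)]
    obtain ⟨i, hi, j, hj, hij, e⟩ := Finset.exists_ne_map_eq_of_card_lt_of_maps_to
      (s := Finset.range (U.card + 1)) (t := U) (by simp) (fun n _ => hxU n)
    simp only [Finset.mem_range] at hi hj
    rcases lt_or_gt_of_ne hij with hlt | hlt
    · exact hne i j hlt (by omega) e
    · exact hne j i hlt (by omega) e.symm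
  refine ⟨r, hr1, hrU, ?_⟩
  -- Unfolding `s (x (n + 1)) > L * s (x n) - 1` from `x 0 = f a`.
  have hchain : ∀ n, s (f a) * L ^ (n + 1) - ∑ j ∈ Finset.range (n + 1), L ^ j < t (π (x n)) := by
    intro n
    induction n with
    | zero => simpa [hx0, mul_comm, sub_lt_iff_lt_add] using hload _ (hxU 0)
    | succ n ih =>
      have h1 := hload _ (hxU (n + 1))
      have h2 := hopt _ (hπ _ (hxU n))
      rw [← hxs] at h2
      have h3 : s (f a) * L ^ (n + 1 + 1) - ∑ j ∈ Finset.range (n + 1 + 1), L ^ j =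
          L * (s (f a) * L ^ (n + 1) - ∑ j ∈ Finset.range (n + 1), L ^ j) - 1 := by
        rw [Finset.sum_range_succ', mul_sub, Finset.mul_sum]
        simp only [pow_succ' L]
        ring
      rw [h3]
      nlinarith
  obtain ⟨n, rfl⟩ : ∃ n, r = n + 1 := ⟨r - 1, by omega⟩
  have h1 := hchain n
  rw [hxs] at hxr
  have h2 := hopt' _ (hπ _ (hxU n)) hxr
  have h3 := h.one_le _ (hπ _ (hxU n))
  have h4 : 1 ≤ L ^ (n + 1) := one_le_pow₀ hL1.le
  rw [Finset.sum_range_succ'] at h1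
  rw [lptPoly, Finset.sum_Ico_eq_sum_range]
  simp only [Nat.add_sub_cancel, add_comm 1, pow_zero] at h1 ⊢
  nlinarith

end Overload

end Overload

/-! ### The polynomial -/

/-- `lptPoly m x / x ^ m` is strictly increasing in `x > 0`. -/
theorem lptPoly_pos_of_root_lt {m : ℕ} (hm : m ≠ 0) {x y : ℝ} (hx : 0 < x) (hxy : x < y)
    (h : lptPoly m x = 0) : 0 < lptPoly m y := by
  have key : lptPoly m x * y ^ m < lptPoly m y * x ^ m := by
    have h1 : x ^ m < y ^ m := pow_lt_pow_left₀ hxy hx.le hm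
    have h2 : (∑ j ∈ Finset.Ico 1 m, y ^ j) * x ^ m ≤ (∑ j ∈ Finset.Ico 1 m, x ^ j) * y ^ m := by
      rw [Finset.sum_mul, Finset.sum_mul]
      refine Finset.sum_le_sum fun j hj => ?_
      have hj := (Finset.mem_Ico.1 hj).2
      rw [← Nat.add_sub_of_le hj.le, pow_add, pow_add]
      have := pow_le_pow_left₀ hx.le hxy.le (m - j)
      have hp : 0 ≤ y ^ j * x ^ j := by have := hx.trans hxy; positivity
      nlinarith
    unfold lptPoly
    nlinarith
  rw [h, zero_mul] at key
  exact pos_of_mul_pos_left key (by positivity)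

theorem lptPoly_root_unique {m : ℕ} (hm : m ≠ 0) {x y : ℝ} (hx : 0 < x) (hy : 0 < y)
    (hx0 : lptPoly m x = 0) (hy0 : lptPoly m y = 0) : x = y := by
  rcases lt_trichotomy x y with h | h | h
  · exact absurd hy0 (lptPoly_pos_of_root_lt hm hx h hx0).ne'
  · exact h
  · exact absurd hx0 (lptPoly_pos_of_root_lt hm hy h hy0).ne'

theorem lptPoly_succ {m : ℕ} (hm : 1 ≤ m) (x : ℝ) :
    lptPoly (m + 1) x = lptPoly m x + x ^ m * (2 * x - 3) := by
  rw [lptPoly, lptPoly, Finset.sum_Ico_succ_top hm]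
  ring

/-- Below `3 / 2` the polynomials decrease with the degree, so that the root bounds the ratio on
fewer processors too. -/
theorem lptPoly_anti {x : ℝ} (hx0 : 0 ≤ x) (hx : x ≤ 3 / 2) {r m : ℕ} (hr : 1 ≤ r) (hrm : r ≤ m) :
    lptPoly m x ≤ lptPoly r x := by
  induction m, hrm using Nat.le_induction with
  | base => exact le_rfl
  | succ m hm ih =>
    rw [lptPoly_succ (hr.trans hm)]
    nlinarith [pow_nonneg hx0 m]

theorem exists_lptPoly_root {m : ℕ} {a b : ℝ} (hab : a ≤ b) (ha : lptPoly m a < 0)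
    (hb : 0 < lptPoly m b) : ∃ x ∈ Set.Ioo a b, lptPoly m x = 0 := by
  have hc : Continuous (lptPoly m) := by unfold lptPoly; fun_prop
  exact intermediate_value_Ioo hab hc.continuousOn ⟨ha, hb⟩

/-! ### The upper bound -/

/-- With one task more than processors the cycle argument applies. With more tasks, the bound on the
total size contradicts the lower bound on the total excess; `hm` is the numerical condition on `m`
and `L` that makes the two incompatible. -/
theorem not_overload {ι τ : Type*} [DecidableEq ι] [DecidableEq τ] {L : ℝ} {s : ι → ℝ} {t : τ → ℝ}
    {A f : τ → ι} {z : τ} {U : Finset ι} {T : Finset τ} {m : ℕ} (hL1 : 1 < L) (hL2 : L ≤ 3 / 2)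
    (hroot : lptPoly m L = 0) (hm : m - 1 ≤ (L - 1) * (2 * L ^ 2 + L + m - 2)) (hU : U.card ≤ m) :
    ¬ Overload L s t A f z U T := by
  intro h
  obtain ⟨U', hU', T', h, hs⟩ := h.exists_surj
  have hk : U'.card ≤ m := (Finset.card_le_card hU').trans hU
  have hle : U'.card + 1 ≤ T'.card := by
    rw [← Finset.card_erase_add_one h.mem]
    refine Nat.add_le_add_right (Finset.card_le_card_of_surjOn A fun p hp => ?_) 1
    obtain ⟨i, hi, hip⟩ := h.exists_map_eq hL1.le hp (hs p hp)
    exact ⟨i, hi, hip⟩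
  rcases hle.eq_or_lt with he | hlt
  · obtain ⟨r, hr1, hr2, hr⟩ := h.exists_lptPoly_neg hL1 hs he.symm
    linarith [lptPoly_anti (by linarith) hL2 hr1 (hr2.trans hk)]
  · have h1 := h.sum_size_lt (by linarith)
    have h2 := h.sum_excess_ge hL1 hL2 hs
    rw [Finset.sum_sub_distrib, Finset.sum_const, nsmul_eq_mul, mul_one] at h2
    have h3 : (U'.card : ℝ) + 2 ≤ T'.card := by exact_mod_cast hlt
    have h4 : (U'.card : ℝ) ≤ m := by exact_mod_cast hk
    have h5 : (U'.card : ℝ) + 2 * L ^ 2 + L - 2 ≤ ∑ i ∈ T', t i := by linarith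
    nlinarith

theorem busyTime_eq_div {m n : ℕ} (s : Fin m → ℝ) (t : Fin n → ℝ) (A : Fin n → Fin m)
    (S : Finset (Fin n)) (p : Fin m) :
    busyTime s t A S p = (∑ i ∈ S with A i = p, t i) / s p := by
  rw [busyTime, Finset.sum_div]

theorem busyTime_le_makespan {m n : ℕ} (s : Fin m → ℝ) (t : Fin n → ℝ) (A : Fin n → Fin m)
    (p : Fin m) : busyTime s t A Finset.univ p ≤ makespan s t A :=
  le_ciSup (f := fun p => busyTime s t A Finset.univ p) (Set.finite_range _).bddAbove p

/-- An LPT schedule of ratio more than `L` yields an `Overload`: cut it off at the last task of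
positive size on a processor that attains the makespan. -/
theorem IsLPTSchedule.makespan_le_mul_optMakespan {m n : ℕ} {s : Fin m → ℝ} {t : Fin n → ℝ}
    {A : Fin n → Fin m} {L : ℝ} (hL : 0 ≤ L) (hm : m ≠ 0) (hs : ∀ p, 0 < s p) (ht : ∀ i, 0 ≤ t i)
    (hA : IsLPTSchedule s t A)
    (hno : ∀ (s' : Fin m → ℝ) (t' : Fin n → ℝ) (f : Fin n → Fin m) (z : Fin n)
      (T : Finset (Fin n)), ¬ Overload L s' t' A f z Finset.univ T) :
    makespan s t A ≤ L * optMakespan s t := by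
  have : NeZero m := ⟨hm⟩
  by_contra! hlt
  obtain ⟨σ, hσ, hlpt⟩ := hA
  obtain ⟨f, hf⟩ := exists_eq_ciInf_of_finite (f := fun B : Fin n → Fin m => makespan s t B)
  obtain ⟨p, hp⟩ := exists_eq_ciSup_of_finite (f := fun p => busyTime s t A Finset.univ p)
  change makespan s t f = optMakespan s t at hf
  change busyTime s t A Finset.univ p = makespan s t A at hp
  set C := optMakespan s t with hC
  have hload : ∀ q, ∑ i with f i = q, t i ≤ C * s q := fun q => by
    have h1 := busyTime_le_makespan s t f q
    rwa [hf, busyTime_eq_div, div_le_iff₀ (hs q)] at h1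
  have hC0 : 0 ≤ C :=
    nonneg_of_mul_nonneg_left ((Finset.sum_nonneg fun i _ => ht i).trans (hload p)) (hs p)
  rw [← hp] at hlt
  -- Tasks of size `0` are skipped, since sizes are to be divided by that of the last task.
  have hne : (Finset.univ.filter fun k => A (σ k) = p ∧ 0 < t (σ k)).Nonempty := by
    by_contra hemp
    rw [Finset.not_nonempty_iff_eq_empty, Finset.filter_eq_empty_iff] at hemp
    have : busyTime s t A Finset.univ p = 0 := by
      refine Finset.sum_eq_zero fun i hi => ?_
      have h1 := @hemp (σ.symm i) (Finset.mem_univ _)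
      simp only [Equiv.apply_symm_apply, (Finset.mem_filter.1 hi).2, true_and, not_lt] at h1
      rw [le_antisymm h1 (ht i), zero_div]
    rw [this] at hlt
    nlinarith
  obtain ⟨k, hk, hkmax⟩ := Finset.exists_max_image _ id hne
  obtain ⟨-, hkp, hk0⟩ := Finset.mem_filter.1 hk
  have herase : ((Finset.Iic k).image σ).erase (σ k) = (Finset.Iio k).image σ := by
    rw [← Finset.image_erase σ.injective, Finset.Iic_erase]
  have hbusy : busyTime s t A Finset.univ p =
      busyTime s t A ((Finset.Iio k).image σ) p + t (σ k) / s p := by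
    have h1 : busyTime s t A Finset.univ p = busyTime s t A ((Finset.Iic k).image σ) p := by
      refine (Finset.sum_subset (Finset.filter_subset_filter _ (Finset.subset_univ _)) ?_).symm
      intro i hi hi'
      have hip := (Finset.mem_filter.1 hi).2
      by_contra h0
      have hi0 : 0 < t i := (ht i).lt_of_ne fun e => h0 (by rw [← e, zero_div])
      have h2 := hkmax (σ.symm i) (by simp [hip, hi0])
      have h3 : i ∈ (Finset.Iic k).image σ :=
        Finset.mem_image.2 ⟨σ.symm i, by simpa using h2, by simp⟩
      exact hi' (Finset.mem_filter.2 ⟨h3, hip⟩)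
    rw [h1, busyTime, busyTime, ← herase, Finset.filter_erase, add_comm]
    refine (Finset.add_sum_erase _ (fun i => t i / s p) ?_).symm
    exact Finset.mem_filter.2 ⟨Finset.mem_image_of_mem σ (Finset.mem_Iic.2 le_rfl), hkp⟩
  rw [hbusy, ← hkp] at hlt
  refine hno (fun q => C * s q / t (σ k)) (fun i => t i / t (σ k)) f (σ k)
    ((Finset.Iic k).image σ) ⟨?_, div_self hk0.ne', ?_, by simp, by simp, ?_, ?_⟩
  · exact Finset.mem_image_of_mem σ (Finset.mem_Iic.2 le_rfl)
  · intro i hi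
    obtain ⟨j, hj, rfl⟩ := Finset.mem_image.1 hi
    exact (one_le_div hk0).2 (hσ (Finset.mem_Iic.1 hj))
  · intro q _
    rw [← Finset.sum_div]
    refine div_le_div_of_nonneg_right (le_trans ?_ (hload q)) hk0.le
    exact Finset.sum_le_sum_of_subset_of_nonneg
      (Finset.filter_subset_filter _ (Finset.subset_univ _)) fun i _ _ => ht i
  · intro q _
    have h1 := hlt.trans_le (hlpt k q)
    rw [busyTime_eq_div, ← add_div, lt_div_iff₀ (hs q)] at h1
    rw [herase, ← Finset.sum_div, div_add_one hk0.ne', ← mul_div_assoc, ← mul_assoc]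
    exact div_lt_div_of_pos_right h1 hk0

/-! ### The tight instance -/

/-- The sequence `2, 2 * ρ - 1, …`: its first `m` terms are the processor speeds of the tight
instance, and the terms `1, …, m`, together with one more task of size `1`, are its task sizes. By
the recursion, adding a task of size `1` to a processor of speed `tightSeq ρ j` that already has the
task `tightSeq ρ (j + 1)` makes it finish at time `ρ`. -/
noncomputable def tightSeq (ρ : ℝ) : ℕ → ℝ
  | 0 => 2
  | j + 1 => ρ * tightSeq ρ j - 1

theorem tightSeq_succ (ρ : ℝ) (j : ℕ) : tightSeq ρ (j + 1) = ρ * tightSeq ρ j - 1 := rfl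

theorem tightSeq_eq (ρ : ℝ) (n : ℕ) :
    tightSeq ρ n = 2 * ρ ^ n - ∑ j ∈ Finset.range n, ρ ^ j := by
  induction n with
  | zero => simp [tightSeq]
  | succ n ih =>
    rw [tightSeq, ih, Finset.sum_range_succ', mul_sub, Finset.mul_sum]
    simp only [pow_succ' ρ]
    ring

theorem tightSeq_eq_one {ρ : ℝ} {m : ℕ} (hm : m ≠ 0) (h : lptPoly m ρ = 0) :
    tightSeq ρ m = 1 := by
  rw [tightSeq_eq, Finset.range_eq_Ico, Finset.sum_eq_sum_Ico_succ_bot (Nat.pos_of_ne_zero hm)]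
  rw [lptPoly] at h
  simp only [pow_zero, zero_add]
  linarith

theorem tightSeq_strictAnti {ρ : ℝ} (h0 : 0 < ρ) (h : ρ < 3 / 2) : StrictAnti (tightSeq ρ) := by
  refine strictAnti_nat_of_succ_lt fun n => ?_
  induction n with
  | zero => simp only [tightSeq]; linarith
  | succ n ih =>
    have h1 := tightSeq_succ ρ (n + 1)
    have h2 := tightSeq_succ ρ n
    nlinarith

/-- The speeds of the tight instance. -/
noncomputable def tightSpeed (ρ : ℝ) (m : ℕ) (p : Fin m) : ℝ := tightSeq ρ p

/-- The task sizes of the tight instance. The `min` makes the last two tasks equal; both have size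
`tightSeq ρ m = 1`. -/
noncomputable def tightTask (ρ : ℝ) (m : ℕ) (i : Fin (m + 1)) : ℝ := tightSeq ρ (min (i + 1) m)

theorem tightTask_castSucc (ρ : ℝ) {m : ℕ} (p : Fin m) :
    tightTask ρ m p.castSucc = tightSeq ρ (p + 1) := by
  rw [tightTask, Fin.val_castSucc, min_eq_left (by omega)]

theorem tightTask_last (ρ : ℝ) (m : ℕ) : tightTask ρ m (Fin.last m) = tightSeq ρ m := by
  rw [tightTask, Fin.val_last, min_eq_right (by omega)]

theorem busyTime_image {m n : ℕ} (s : Fin m → ℝ) (t : Fin n → ℝ) (A : Fin n → Fin m)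
    (σ : Equiv.Perm (Fin n)) (S : Finset (Fin n)) (p : Fin m) :
    busyTime s t A (S.image σ) p = busyTime s (t ∘ σ) (A ∘ σ) S p := by
  rw [busyTime, busyTime, Finset.filter_image, Finset.sum_image σ.injective.injOn]
  rfl

theorem busyTime_Iio_of_forall {m : ℕ} (s : Fin m → ℝ) (t : Fin (m + 1) → ℝ)
    {B : Fin (m + 1) → Fin m} {k : Fin (m + 1)}
    (hB : ∀ j : Fin m, j.castSucc < k → B j.castSucc = j) (p : Fin m) :
    busyTime s t B (Finset.Iio k) p = if p.castSucc < k then t p.castSucc / s p else 0 := by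
  have hfil : (Finset.Iio k).filter (fun i => B i = p) =
      if p.castSucc < k then {p.castSucc} else ∅ := by
    ext i
    have hi : i < k → ∃ j : Fin m, j.castSucc = i := fun h =>
      Fin.exists_castSucc_eq.2 (h.trans_le (Fin.le_last k)).ne
    split_ifs with hp
    · simp only [Finset.mem_filter, Finset.mem_Iio, Finset.mem_singleton]
      constructor
      · rintro ⟨h1, h2⟩
        obtain ⟨j, rfl⟩ := hi h1
        rw [← h2, hB j h1]
      · rintro rfl
        exact ⟨hp, hB p hp⟩
    · simp only [Finset.mem_filter, Finset.mem_Iio, Finset.notMem_empty, iff_false, not_and]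
      intro h1 h2
      obtain ⟨j, rfl⟩ := hi h1
      rw [hB j h1] at h2
      exact hp (h2 ▸ h1)
  rw [busyTime, hfil]
  split_ifs <;> simp

/-- The conditions on `ρ` under which LPT has ratio `ρ` on the tight instance. That
`ρ < 3 / 2` makes `tightSeq ρ` decreasing. -/
structure IsTightRatio (ρ : ℝ) (m : ℕ) : Prop where
  ne_zero : m ≠ 0
  one_lt : 1 < ρ
  lt_three_halves : ρ < 3 / 2
  root : lptPoly m ρ = 0

namespace IsTightRatio

variable {ρ : ℝ} {m : ℕ}

theorem pos (h : IsTightRatio ρ m) : 0 < ρ := one_pos.trans h.one_lt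

theorem strictAnti (h : IsTightRatio ρ m) : StrictAnti (tightSeq ρ) :=
  tightSeq_strictAnti h.pos h.lt_three_halves

theorem tightSeq_eq_one (h : IsTightRatio ρ m) : tightSeq ρ m = 1 :=
  _root_.tightSeq_eq_one h.ne_zero h.root

theorem one_le_tightSeq (h : IsTightRatio ρ m) {j : ℕ} (hj : j ≤ m) : 1 ≤ tightSeq ρ j :=
  h.tightSeq_eq_one.symm.le.trans (h.strictAnti.antitone hj)

theorem tightSpeed_pos (h : IsTightRatio ρ m) (p : Fin m) : 0 < tightSpeed ρ m p :=
  one_pos.trans_le (h.one_le_tightSeq p.2.le)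

theorem one_le_tightTask (h : IsTightRatio ρ m) (i : Fin (m + 1)) : 1 ≤ tightTask ρ m i :=
  h.one_le_tightSeq (min_le_right _ _)

theorem tightTask_antitone (h : IsTightRatio ρ m) : Antitone (tightTask ρ m) := fun _ _ hij =>
  h.strictAnti.antitone (min_le_min_right m (Nat.add_le_add_right hij 1))

theorem task_div_speed_lt_one (h : IsTightRatio ρ m) (p : Fin m) :
    tightTask ρ m p.castSucc / tightSpeed ρ m p < 1 := by
  rw [div_lt_one (h.tightSpeed_pos p), tightTask_castSucc]
  exact h.strictAnti (Nat.lt_succ_self _)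

theorem task_add_div_speed (h : IsTightRatio ρ m) (p : Fin m) (x : ℝ) :
    tightTask ρ m p.castSucc / tightSpeed ρ m p + x / tightSpeed ρ m p =
      ρ + (x - 1) / tightSpeed ρ m p := by
  have hp := (h.tightSpeed_pos p).ne'
  rw [tightTask_castSucc, tightSeq_succ]
  change (ρ * tightSpeed ρ m p - 1) / _ + _ = _
  field_simp
  ring

/-- If the tasks before `k` are on the processors of their own index, then `k` finishes strictly
earliest on processor `k`, so that no tie occurs. -/
theorem cost_lt (h : IsTightRatio ρ m) {B : Fin (m + 1) → Fin m} {k q : Fin m}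
    (hB : ∀ j : Fin m, j.castSucc < k.castSucc → B j.castSucc = j) (hqk : q ≠ k) :
    busyTime (tightSpeed ρ m) (tightTask ρ m) B (Finset.Iio k.castSucc) k +
        tightTask ρ m k.castSucc / tightSpeed ρ m k <
      busyTime (tightSpeed ρ m) (tightTask ρ m) B (Finset.Iio k.castSucc) q +
        tightTask ρ m k.castSucc / tightSpeed ρ m q := by
  rw [busyTime_Iio_of_forall _ _ hB, busyTime_Iio_of_forall _ _ hB, if_neg (lt_irrefl _), zero_add]
  refine (h.task_div_speed_lt_one k).trans_le ?_
  split_ifs with hq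
  · rw [h.task_add_div_speed]
    have := div_nonneg (sub_nonneg.2 (h.one_le_tightTask k.castSucc)) (h.tightSpeed_pos q).le
    linarith [h.one_lt]
  · have hkq : k < q := lt_of_le_of_ne (by simpa using hq) hqk.symm
    rw [zero_add, one_le_div (h.tightSpeed_pos q), tightTask_castSucc]
    exact h.strictAnti.antitone hkq

/-- The last task finishes at time `ρ` wherever it goes. -/
theorem cost_last (h : IsTightRatio ρ m) {B : Fin (m + 1) → Fin m}
    (hB : ∀ j : Fin m, B j.castSucc = j) (q : Fin m) :
    busyTime (tightSpeed ρ m) (tightTask ρ m) B (Finset.Iio (Fin.last m)) q +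
      tightTask ρ m (Fin.last m) / tightSpeed ρ m q = ρ := by
  rw [busyTime_Iio_of_forall _ _ fun j _ => hB j, if_pos (Fin.castSucc_lt_last q),
    h.task_add_div_speed, tightTask_last, h.tightSeq_eq_one]
  simp

theorem makespan_eq (h : IsTightRatio ρ m) {B : Fin (m + 1) → Fin m}
    (hB : ∀ j : Fin m, B j.castSucc = j) :
    makespan (tightSpeed ρ m) (tightTask ρ m) B = ρ := by
  have : NeZero m := ⟨h.ne_zero⟩
  have huniv : (Finset.univ : Finset (Fin (m + 1))) =
      insert (Fin.last m) (Finset.Iio (Fin.last m)) := by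
    ext i
    simp only [Finset.mem_univ, Finset.mem_insert, Finset.mem_Iio, true_iff]
    exact (Fin.le_last i).eq_or_lt
  have hbusy : ∀ q, busyTime (tightSpeed ρ m) (tightTask ρ m) B Finset.univ q =
      if B (Fin.last m) = q then ρ
      else tightTask ρ m q.castSucc / tightSpeed ρ m q := fun q => by
    have h3 := h.cost_last hB q
    have h4 := busyTime_Iio_of_forall (tightSpeed ρ m) (tightTask ρ m) (k := Fin.last m)
      (fun j _ => hB j) q
    rw [if_pos (Fin.castSucc_lt_last q)] at h4
    rw [busyTime, huniv, Finset.filter_insert]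
    split_ifs with hq
    · rw [Finset.sum_insert (by simp), add_comm]
      exact h3
    · exact h4
  refine le_antisymm (ciSup_le fun q => ?_) ?_
  · rw [hbusy]
    split_ifs
    · exact le_rfl
    · exact ((h.task_div_speed_lt_one q).trans h.one_lt).le
  · have := busyTime_le_makespan (tightSpeed ρ m) (tightTask ρ m) B (B (Fin.last m))
    rwa [hbusy, if_pos rfl] at this

theorem makespan_of_isLPTSchedule (h : IsTightRatio ρ m) {A : Fin (m + 1) → Fin m}
    (hA : IsLPTSchedule (tightSpeed ρ m) (tightTask ρ m) A) :
    makespan (tightSpeed ρ m) (tightTask ρ m) A = ρ := by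
  obtain ⟨σ, hσ, hlpt⟩ := hA
  -- Two tasks have equal size, so `σ` need not be the identity, but it does not change the sizes.
  have htσ : tightTask ρ m ∘ σ = tightTask ρ m :=
    Tuple.unique_antitone (τ := Equiv.refl _) hσ h.tightTask_antitone
  have htσ' : ∀ k, tightTask ρ m (σ k) = tightTask ρ m k := congrFun htσ
  simp only [busyTime_image, htσ, htσ'] at hlpt
  have hB : ∀ j : Fin m, (A ∘ σ) j.castSucc = j := by
    intro j
    induction j using WellFoundedLT.induction with
    | ind j ih =>
      by_contra hne
      exact absurd (hlpt j.castSucc j)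
        (not_le.2 (h.cost_lt (fun i hi => ih i (by simpa using hi)) hne))
  refine Eq.trans (iSup_congr fun p => ?_) (h.makespan_eq hB)
  have hp := busyTime_image (tightSpeed ρ m) (tightTask ρ m) A σ Finset.univ p
  rwa [htσ, Finset.image_univ_equiv] at hp

theorem exists_isLPTSchedule (h : IsTightRatio ρ m) :
    ∃ A, IsLPTSchedule (tightSpeed ρ m) (tightTask ρ m) A := by
  have : NeZero m := ⟨h.ne_zero⟩
  let B : Fin (m + 1) → Fin m := Fin.lastCases 0 id
  have hB : ∀ j : Fin m, B j.castSucc = j := fun j => by simp [B]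
  refine ⟨B, Equiv.refl _, h.tightTask_antitone, fun k p => ?_⟩
  simp only [Equiv.coe_refl, Finset.image_id, id]
  induction k using Fin.lastCases with
  | last => rw [h.cost_last hB, h.cost_last hB]
  | cast k =>
    rw [hB]
    by_cases hpk : p = k
    · rw [hpk]
    · exact (h.cost_lt (fun j _ => hB j) hpk).le

theorem sum_tightTask (h : IsTightRatio ρ m) :
    ∑ i, tightTask ρ m i = ∑ p, tightSpeed ρ m p := by
  have h3 := Finset.sum_range_succ (tightSeq ρ) m
  rw [Finset.sum_range_succ', h.tightSeq_eq_one, tightSeq] at h3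
  simp only [Fin.sum_univ_castSucc, tightTask_castSucc, tightTask_last, tightSpeed,
    h.tightSeq_eq_one]
  rw [Fin.sum_univ_eq_sum_range (tightSeq ρ), Fin.sum_univ_eq_sum_range fun j => tightSeq ρ (j + 1)]
  linarith

/-- The total size equals the total speed, so no schedule finishes before time `1`. -/
theorem one_le_makespan (h : IsTightRatio ρ m) (B : Fin (m + 1) → Fin m) :
    1 ≤ makespan (tightSpeed ρ m) (tightTask ρ m) B := by
  have : NeZero m := ⟨h.ne_zero⟩
  by_contra! hlt
  have h3 : ∀ p, ∑ i with B i = p, tightTask ρ m i < tightSpeed ρ m p := fun p => by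
    have := (busyTime_le_makespan (tightSpeed ρ m) (tightTask ρ m) B p).trans_lt hlt
    rwa [busyTime_eq_div, div_lt_one (h.tightSpeed_pos p)] at this
  have h4 := Finset.sum_lt_sum_of_nonempty Finset.univ_nonempty fun p _ => h3 p
  rw [Finset.sum_fiberwise, h.sum_tightTask] at h4
  exact lt_irrefl _ h4

/-- Give the two tasks of size `1` to the first processor, of speed `2`, and each other task to the
processor whose speed equals its size. -/
theorem exists_makespan_le_one (h : IsTightRatio ρ m) :
    ∃ B, makespan (tightSpeed ρ m) (tightTask ρ m) B ≤ 1 := by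
  obtain ⟨l, rfl⟩ := Nat.exists_eq_succ_of_ne_zero h.ne_zero
  let B : Fin (l + 2) → Fin (l + 1) := fun i => if hi : i.val + 1 < l + 1 then ⟨i + 1, hi⟩ else 0
  refine ⟨B, ciSup_le fun p => ?_⟩
  rw [busyTime_eq_div, div_le_one (h.tightSpeed_pos p)]
  induction p using Fin.cases with
  | zero =>
    have hfil : Finset.univ.filter (fun i => B i = 0) =
        {(Fin.last l).castSucc, Fin.last (l + 1)} := by
      ext i
      simp only [B, Finset.mem_filter, Finset.mem_univ, true_and, Finset.mem_insert,
        Finset.mem_singleton, Fin.ext_iff, Fin.val_castSucc, Fin.val_last]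
      split_ifs with hi
      · simp only [Fin.val_zero]; omega
      · simp only [Fin.val_zero, true_iff]; omega
    rw [hfil, Finset.sum_pair (Fin.castSucc_lt_last _).ne, tightTask_castSucc, tightTask_last,
      Fin.val_last, h.tightSeq_eq_one]
    norm_num [tightSpeed, tightSeq]
  | succ p =>
    have hfil : Finset.univ.filter (fun i => B i = p.succ) = {p.castSucc.castSucc} := by
      ext i
      simp only [B, Finset.mem_filter, Finset.mem_univ, true_and,
        Finset.mem_singleton, Fin.ext_iff, Fin.val_castSucc, Fin.val_succ]
      split_ifs with hi
      · simp
      · simp only [Fin.val_zero]; omega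
    rw [hfil, Finset.sum_singleton, tightTask_castSucc]
    rfl

theorem optMakespan_eq_one (h : IsTightRatio ρ m) :
    optMakespan (tightSpeed ρ m) (tightTask ρ m) = 1 := by
  have : NeZero m := ⟨h.ne_zero⟩
  obtain ⟨B, hB⟩ := h.exists_makespan_le_one
  exact le_antisymm ((ciInf_le (Set.finite_range _).bddBelow B).trans hB)
    (le_ciInf h.one_le_makespan)

end IsTightRatio

/-! ### The worst-case ratio -/

/-- `a` and `b` bracket the root. The last hypothesis is the numerical condition of `not_overload`
at `a`, which then holds at the root, as the right-hand side is increasing. -/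
theorem lpt_ratio {m : ℕ} {a b : ℝ} (hm : m ≠ 0) (ha1 : 1 < a) (hab : a ≤ b) (hb : b ≤ 3 / 2)
    (ha : lptPoly m a < 0) (hb0 : 0 < lptPoly m b)
    (hma : (m : ℝ) - 1 ≤ (a - 1) * (2 * a ^ 2 + a + m - 2)) :
    ∃ ρ ∈ Set.Ioo a b,
      (0 < ρ ∧ lptPoly m ρ = 0 ∧ ∀ x : ℝ, 0 < x → lptPoly m x = 0 → x = ρ) ∧
      (∀ (n : ℕ) (s : Fin m → ℝ) (t : Fin n → ℝ) (A : Fin n → Fin m),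
        (∀ p, 0 < s p) → (∀ i, 0 ≤ t i) → IsLPTSchedule s t A →
          makespan s t A ≤ ρ * optMakespan s t) ∧
      (∃ (s : Fin m → ℝ) (t : Fin (m + 1) → ℝ),
        (∀ p, 0 < s p) ∧ (∀ i, 0 ≤ t i) ∧ 0 < optMakespan s t ∧
          (∃ A, IsLPTSchedule s t A) ∧
          ∀ A, IsLPTSchedule s t A → makespan s t A / optMakespan s t = ρ) := by
  obtain ⟨ρ, hρ, hroot⟩ := exists_lptPoly_root hab ha hb0
  have hρ1 : 1 < ρ := ha1.trans hρ.1
  have hρ2 : ρ < 3 / 2 := hρ.2.trans_le hb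
  have htight : IsTightRatio ρ m := ⟨hm, hρ1, hρ2, hroot⟩
  have hmρ : (m : ℝ) - 1 ≤ (ρ - 1) * (2 * ρ ^ 2 + ρ + m - 2) := by
    have hm0 : (0 : ℝ) ≤ m := m.cast_nonneg
    refine hma.trans (mul_le_mul ?_ ?_ ?_ ?_)
    · linarith [hρ.1]
    · nlinarith [hρ.1]
    · nlinarith
    · linarith
  refine ⟨ρ, hρ, ⟨htight.pos, hroot, fun x hx hx0 =>
    lptPoly_root_unique hm hx htight.pos hx0 hroot⟩, ?_, ?_⟩
  · intro n s t A hs ht hA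
    exact hA.makespan_le_mul_optMakespan htight.pos.le hm hs ht fun s' t' f z T =>
      not_overload hρ1 hρ2.le hroot hmρ (by simp)
  · refine ⟨tightSpeed ρ m, tightTask ρ m, htight.tightSpeed_pos,
      fun i => zero_le_one.trans (htight.one_le_tightTask i), ?_, htight.exists_isLPTSchedule,
      fun A hA => ?_⟩
    · rw [htight.optMakespan_eq_one]
      exact one_pos
    · rw [htight.optMakespan_eq_one, htight.makespan_of_isLPTSchedule hA, div_one]

theorem mainTheorem1 (m : ℕ) (hm : m = 3 ∨ m = 4 ∨ m = 5) :
    ∃ ρ : ℝ,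
      -- `ρ` is the unique positive root of the polynomial
      (0 < ρ ∧ lptPoly m ρ = 0 ∧ ∀ x : ℝ, 0 < x → lptPoly m x = 0 → x = ρ) ∧
      -- its approximate value
      (m = 3 → |ρ - 1.38| < 0.005) ∧
      (m = 4 → |ρ - 1.43| < 0.005) ∧
      (m = 5 → |ρ - 1.46| < 0.005) ∧
      -- upper bound, for every instance and every way of breaking ties
      (∀ (n : ℕ) (s : Fin m → ℝ) (t : Fin n → ℝ) (A : Fin n → Fin m),
        (∀ p, 0 < s p) → (∀ i, 0 ≤ t i) → IsLPTSchedule s t A →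
          makespan s t A ≤ ρ * optMakespan s t) ∧
      -- tightness: on some instance with `m + 1` tasks LPT has ratio `ρ`, however ties are broken
      (∃ (s : Fin m → ℝ) (t : Fin (m + 1) → ℝ),
        (∀ p, 0 < s p) ∧ (∀ i, 0 ≤ t i) ∧ 0 < optMakespan s t ∧
          (∃ A, IsLPTSchedule s t A) ∧
          ∀ A, IsLPTSchedule s t A → makespan s t A / optMakespan s t = ρ) := by
  rcases hm with rfl | rfl | rfl
  · obtain ⟨ρ, ⟨ha, hb⟩, hroot, hupper, htight⟩ := lpt_ratio (m := 3) (a := 1.38) (b := 1.384)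
      (by norm_num) (by norm_num) (by norm_num) (by norm_num)
      (by norm_num [lptPoly, Finset.sum_Ico_succ_top])
      (by norm_num [lptPoly, Finset.sum_Ico_succ_top]) (by norm_num)
    refine ⟨ρ, hroot, fun _ => ?_, by simp, by simp, hupper, htight⟩
    rw [abs_lt]
    constructor <;> linarith
  · obtain ⟨ρ, ⟨ha, hb⟩, hroot, hupper, htight⟩ := lpt_ratio (m := 4) (a := 1.43) (b := 1.434)
      (by norm_num) (by norm_num) (by norm_num) (by norm_num)
      (by norm_num [lptPoly, Finset.sum_Ico_succ_top])
      (by norm_num [lptPoly, Finset.sum_Ico_succ_top]) (by norm_num)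
    refine ⟨ρ, hroot, by simp, fun _ => ?_, by simp, hupper, htight⟩
    rw [abs_lt]
    constructor <;> linarith
  · -- The lower end has to be this close to the root `1.4591…`: the last
    -- hypothesis fails at `1.458`.
    obtain ⟨ρ, ⟨ha, hb⟩, hroot, hupper, htight⟩ := lpt_ratio (m := 5) (a := 1.459) (b := 1.46)
      (by norm_num) (by norm_num) (by norm_num) (by norm_num)
      (by norm_num [lptPoly, Finset.sum_Ico_succ_top])
      (by norm_num [lptPoly, Finset.sum_Ico_succ_top]) (by norm_num)
    refine ⟨ρ, hroot, by simp, by simp, fun _ => ?_, hupper, htight⟩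
    rw [abs_lt]
    constructor <;> linarith
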